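/- Let $k\ge 1$ and let $R=\mathbb Z$ or $R=\mathbb Z/2$. Let $K$ be a finite geometric simplicial complex of dimension at most $k$ with each simplex oriented, and let $M$ be an $R$-oriented closed $2k$-manifold, or $M=\mathbb R^{2k}$. Let $\Omega\colon H_k(M;R)\times H_k(M;R)\to R$ be the intersection form, i.e. the cup product form $(\alpha,\beta)\mapsto\langle\alpha\smile\beta,[M]\rangle$ on $H^k(M;R)$ transported to $H_k(M;R)$ by Poincaré duality ($\Omega=0$ if $M=\mathbb R^{2k}$). Fix an isomorphism $H_k(M;R)\cong R^b\oplus T$, where $T$ is the torsion submodule ($T=0$ if $R=\mathbb Z/2$), and let $A_\Omega\in R^{b\times b}$ be the matrix of $\Omega$ on the standard basis of $R^b$. Cochains are functions $\xi$ with values in $R$ on the products $\sigma\times\tau$ of disjoint $k$-simplices of $K$. For a $(k-1)$-simplex $\eta$ and a $k$-simplex $\mu$ of $K$ with $\eta\cap\mu=\emptyset$ the finger move cochain $\varphi_{\eta,\mu}$ takes on $\sigma\times\tau$ the value $[\eta:\sigma]$ if $\eta\subseteq\sigma$ and $\mu=\tau$, the value $(-1)^k[\eta:\tau]$ if $\eta\subseteq\tau$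 and $\mu=\sigma$, and $0$ otherwise, where $[\eta:\sigma]=\pm1$ is the incidence number. Let $F$ be the $R$-span of all $\varphi_{\eta,\mu}$, and write $[\xi]$ for the class of $\xi$ modulo $F$. The van Kampen obstruction is $\tilde o(K)=[\vartheta_g]$, where $g\colon|K|\to\mathbb R^{2k}$ is any PL general position map and $\vartheta_g(\sigma\times\tau)=g(\sigma)\cdot g(\tau)$ is the (signed, with values in $R$) intersection number. Let $\vartheta$ be any cochain with $[\vartheta]=\tilde o(K)$. For a homomorphism $\psi\colon C_k(K;R)\to H_k(M;R)$ put $\omega_\psi(\sigma\times\tau)=\Omega(\psi(\sigma),\psi(\tau))$. Then there is a homomorphism $\psi\colon C_k(K;R)\to H_k(M;R)$ with $[\omega_\psi]-\tilde o(K)=0$ if and only if the system of quadratic equations $$\sum_{\eta,\mu}x_{\eta,\mu}\,\varphi_{\eta,\mu}(\sigma\times\tau)+y_\sigma^{T}A_\Omega\,y_\tau=\vartheta(\sigma\times\tau),$$ one equation for each pair $(\sigma,\tau)$ of disjoint $k$-simplices of $K$, has a solution in $R$; the unknowns are $x_{\eta,\mu}\in R$, one for each disjoint pair of a $(k-1)$-simplex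 $\eta$ and a $k$-simplex $\mu$ of $K$, and $y_\sigma=(y_\sigma^1,\dots,y_\sigma^b)\in R^b$, one vector for each $k$-simplex $\sigma$ of $K$. -/

import Mathlib

noncomputable section

namespace VanKampen

section Cap

open CategoryTheory CategoryTheory.Limits SimplexCategory
open scoped Simplicial
variable {C : Type*} [Category C] [HasCoproducts.{0} C] [Preadditive C] (X : SSet.{0}) {R : C}

/- Cap product on the chains of a simplicial set -/

/-- The front `p`-face `x|[0, …, p]` of an `n`-simplex. -/
def frontFace {p n : ℕ} (h : p ≤ n) (x : X _⦋n⦌) : X _⦋p⦌ :=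
  X.map (subinterval 0 p (by lia)).op x

/-- The back `q`-face `x|[p, …, p + q]` of a `(p + q)`-simplex. -/
def backFace {p q n : ℕ} (h : p + q = n) (x : X _⦋n⦌) : X _⦋q⦌ :=
  X.map (subinterval p q h.le).op x

/-- Cap product with a `p`-cochain `a`: on an `n`-simplex `x`, with `n = p + q`,
`a ⌢ x = a(x|[0, …, p]) • x|[p, …, n]`. -/
def cap {p q n : ℕ} (h : p + q = n) (a : (X.chainComplex R).X p ⟶ R) :
    (X.chainComplex R).X n ⟶ (X.chainComplex R).X q :=
  Sigma.desc fun x : X _⦋n⦌ =>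
    (X.ιChainComplex (frontFace X (by lia) x) ≫ a) ≫ X.ιChainComplex (backFace X h x)

lemma ι_cap {p q n : ℕ} (h : p + q = n) (a : (X.chainComplex R).X p ⟶ R) (x : X _⦋n⦌) :
    X.ιChainComplex x ≫ cap X h a =
      (X.ιChainComplex (frontFace X (by lia) x) ≫ a) ≫ X.ιChainComplex (backFace X h x) :=
  Sigma.ι_desc _ _

lemma front_δ_le {p n : ℕ} (h : p ≤ n) (x : X _⦋n + 1⦌) (i : Fin (n + 2)) (hi : i.1 ≤ p + 1) :
    frontFace X h (X.δ i x) = X.δ ⟨i.1, by lia⟩ (frontFace X (Nat.succ_le_succ h) x) := by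
  simp only [frontFace, SimplicialObject.δ]
  rw [← Functor.map_comp_apply, ← Functor.map_comp_apply, ← op_comp, ← op_comp]
  refine congrArg (fun f => X.map f x) (congrArg Quiver.Hom.op ?_)
  ext j
  simp [subinterval, SimplexCategory.δ, Fin.succAbove, Fin.lt_def]
  split_ifs <;> simp

lemma front_δ_gt {p n : ℕ} (h : p ≤ n) (x : X _⦋n + 1⦌) (i : Fin (n + 2)) (hi : p < i.1) :
    frontFace X h (X.δ i x) = frontFace X (by lia) x := by
  simp only [frontFace, SimplicialObject.δ]
  rw [← Functor.map_comp_apply, ← op_comp]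
  refine congrArg (fun f => X.map f x) (congrArg Quiver.Hom.op ?_)
  ext j
  simp [subinterval, SimplexCategory.δ, Fin.succAbove, Fin.lt_def]
  lia

lemma back_δ_le {p q n : ℕ} (h : p + q = n) (x : X _⦋n + 1⦌) (i : Fin (n + 2)) (hi : i.1 ≤ p) :
    backFace X h (X.δ i x) = backFace X (p := p + 1) (by lia) x := by
  simp only [backFace, SimplicialObject.δ]
  rw [← Functor.map_comp_apply, ← op_comp]
  refine congrArg (fun f => X.map f x) (congrArg Quiver.Hom.op ?_)
  ext j
  have hj : j.1 < q + 1 := j.2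
  change (i.succAbove (⟨j.1 + p, by lia⟩ : Fin (n + 1))).1 = j.1 + (p + 1)
  simp only [Fin.succAbove, Fin.lt_def]
  split_ifs with h1 <;> simp at h1 ⊢ <;> lia

lemma back_δ_ge {p q n : ℕ} (h : p + q = n) (x : X _⦋n + 1⦌) (i : Fin (n + 2)) (hi : p ≤ i.1) :
    backFace X h (X.δ i x) =
      X.δ ⟨i.1 - p, by lia⟩ (backFace X (p := p) (q := q + 1) (by lia) x) := by
  simp only [backFace, SimplicialObject.δ]
  rw [← Functor.map_comp_apply, ← Functor.map_comp_apply, ← op_comp, ← op_comp]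
  refine congrArg (fun f => X.map f x) (congrArg Quiver.Hom.op ?_)
  ext j
  have hj : j.1 < q + 1 := j.2
  change (i.succAbove (⟨j.1 + p, by lia⟩ : Fin (n + 1))).1 =
    ((⟨i.1 - p, by lia⟩ : Fin (q + 2)).succAbove (⟨j.1, hj⟩ : Fin (q + 1))).1 + p
  simp only [Fin.succAbove, Fin.lt_def]
  split_ifs with h1 h2 h2 <;> simp at h1 h2 ⊢ <;> lia


lemma alternating_sum_split {A : Type*} [AddCommGroup A] {p q n : ℕ} (h : p + q = n)
    (L : Fin (n + 2) → A) (u : Fin (p + 2) → A) (v : Fin (q + 2) → A)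
    (hu : ∀ i : Fin (n + 2), ∀ hi : i.1 ≤ p, L i = u ⟨i.1, by lia⟩)
    (hv : ∀ i : Fin (n + 2), ∀ hi : p < i.1, L i = v ⟨i.1 - p, by lia⟩)
    (huv : u (Fin.last (p + 1)) = v 0) :
    ∑ i, (-1 : ℤ) ^ i.1 • L i =
      ∑ i, (-1 : ℤ) ^ i.1 • u i + (-1 : ℤ) ^ p • ∑ j, (-1 : ℤ) ^ j.1 • v j := by
  have e : (p + 1) + (q + 1) = n + 2 := by lia
  rw [← (finCongr e).sum_comp, Fin.sum_univ_add, Fin.sum_univ_castSucc (n := p + 1),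
    Fin.sum_univ_succ (n := q + 1), huv]
  have h1 : ∀ i : Fin (p + 1), L (finCongr e (Fin.castAdd (q + 1) i)) = u i.castSucc :=
    fun i => hu _ (by simp; lia)
  have h2 : ∀ j : Fin (q + 1), L (finCongr e (Fin.natAdd (p + 1) j)) = v j.succ := by
    intro j
    rw [hv _ (by simp; lia)]
    congr 1
    ext
    simp
    lia
  simp only [h1, h2, smul_add, Finset.smul_sum, smul_smul, ← pow_add]
  simp [pow_add, add_assoc]

/-- The Leibniz rule `a ⌢ ∂x = δa ⌢ x + (-1)^p ∂(a ⌢ x)`. -/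
lemma d_cap {p q n : ℕ} (h : p + q = n) (a : (X.chainComplex R).X p ⟶ R) :
    (X.chainComplex R).d (n + 1) n ≫ cap X h a =
      cap X (p := p + 1) (q := q) (n := n + 1) (by lia) ((X.chainComplex R).d (p + 1) p ≫ a) +
        (-1 : ℤ) ^ p • (cap X (p := p) (q := q + 1) (n := n + 1) (by lia) a ≫
          (X.chainComplex R).d (q + 1) q) := by
  apply SSet.chainComplex_hom_ext
  intro x
  rw [Preadditive.comp_add, Preadditive.comp_zsmul, reassoc_of% ι_cap, ι_cap,
    SSet.ιChainComplex_d_assoc, SSet.ιChainComplex_d_assoc, Category.assoc, 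
    SSet.ιChainComplex_d]
  simp only [Preadditive.sum_comp, Preadditive.comp_sum, Preadditive.zsmul_comp,
    Preadditive.comp_zsmul, ι_cap, Category.assoc]
  refine alternating_sum_split h _ _ _ ?_ ?_ ?_
  · intro i hi
    rw [front_δ_le _ _ _ _ (by lia), back_δ_le _ _ _ _ hi]
  · intro i hi
    rw [front_δ_gt _ _ _ _ hi, back_δ_ge _ _ _ _ hi.le]
  · have e1 := front_δ_le X (p := p) (n := n) (by lia) x ⟨p + 1, by lia⟩ le_rfl
    have e2 := front_δ_gt X (p := p) (n := n) (by lia) x ⟨p + 1, by lia⟩ (by simp)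
    have e3 := back_δ_le X h x ⟨p, by lia⟩ le_rfl
    have e4 := back_δ_ge X h x ⟨p, by lia⟩ le_rfl
    have e5 := e1.symm.trans e2
    have e6 := e3.symm.trans e4
    simp only [Nat.sub_self] at e6
    change X.ιChainComplex (X.δ ⟨p + 1, _⟩ _) ≫ a ≫ _ =
      _ ≫ a ≫ X.ιChainComplex (X.δ ⟨0, _⟩ _)
    rw [e5, ← e6]


lemma cap_add {p q n : ℕ} (h : p + q = n) (a b : (X.chainComplex R).X p ⟶ R) :
    cap X h (a + b) = cap X h a + cap X h b := by
  apply SSet.chainComplex_hom_ext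
  intro x
  simp [ι_cap]

lemma cap_smul {S : Type*} [Semiring S] [Linear S C] {p q n : ℕ} (h : p + q = n) (r : S)
    (a : (X.chainComplex R).X p ⟶ R) : cap X h (r • a) = r • cap X h a := by
  apply SSet.chainComplex_hom_ext
  intro x
  simp [ι_cap]


lemma cap_d_of_cocycle {p q n : ℕ} (h : p + q = n) (a : (X.chainComplex R).X p ⟶ R)
    (ha : (X.chainComplex R).d (p + 1) p ≫ a = 0) :
    cap X (p := p) (q := q + 1) (n := n + 1) (by lia) a ≫ (X.chainComplex R).d (q + 1) q =
      (-1 : ℤ) ^ p • ((X.chainComplex R).d (n + 1) n ≫ cap X h a) := by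
  have hz : cap X (p := p + 1) (q := q) (n := n + 1) (by lia)
      ((X.chainComplex R).d (p + 1) p ≫ a) = 0 := by
    apply SSet.chainComplex_hom_ext
    intro x
    simp [ι_cap, ha]
  rw [d_cap, hz, zero_add, smul_smul, ← mul_pow]
  simp

variable [CategoryWithHomology C]

/-- Capping a cycle with a cocycle gives a cycle. -/
def capCycles {p q n : ℕ} (h : p + q = n) (a : (X.chainComplex R).X p ⟶ R)
    (ha : (X.chainComplex R).d (p + 1) p ≫ a = 0) :
    (X.chainComplex R).cycles n ⟶ (X.chainComplex R).cycles q :=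
  (X.chainComplex R).liftCycles ((X.chainComplex R).iCycles n ≫ cap X h a) _ rfl (by
    cases q with
    | zero => rw [(X.chainComplex R).shape _ _ (by simp), Limits.comp_zero]
    | succ q =>
      obtain rfl : n = p + q + 1 := by lia
      rw [ChainComplex.next_nat_succ, Category.assoc, cap_d_of_cocycle X rfl a ha]
      simp)

lemma capCycles_i {p q n : ℕ} (h : p + q = n) (a : (X.chainComplex R).X p ⟶ R)
    (ha : (X.chainComplex R).d (p + 1) p ≫ a = 0) :
    capCycles X h a ha ≫ (X.chainComplex R).iCycles q =
      (X.chainComplex R).iCycles n ≫ cap X h a :=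
  (X.chainComplex R).liftCycles_i _ _ _ _

/-- The map `H_n(X; R) ⟶ H_q(X; R)`, `[z] ↦ [a ⌢ z]`, given by a `p`-cocycle `a`, `p + q = n`. -/
def capHomology {p q n : ℕ} (h : p + q = n) (a : (X.chainComplex R).X p ⟶ R)
    (ha : (X.chainComplex R).d (p + 1) p ≫ a = 0) : X.homology R n ⟶ X.homology R q :=
  ((X.chainComplex R).homologyIsCokernel (n + 1) n (by simp)).desc
    (CokernelCofork.ofπ (capCycles X h a ha ≫ (X.chainComplex R).homologyπ q) (by
      have e : (X.chainComplex R).toCycles (n + 1) n ≫ capCycles X h a ha =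
          (-1 : ℤ) ^ p • (cap X (p := p) (q := q + 1) (n := n + 1) (by lia) a ≫
            (X.chainComplex R).toCycles (q + 1) q) := by
        rw [← cancel_mono ((X.chainComplex R).iCycles q), Category.assoc, capCycles_i,
          Preadditive.zsmul_comp, Category.assoc, HomologicalComplex.toCycles_i,
          HomologicalComplex.toCycles_i_assoc, cap_d_of_cocycle X h a ha, smul_smul, ← mul_pow]
        simp
      rw [← Category.assoc, e]
      simp))

lemma π_capHomology {p q n : ℕ} (h : p + q = n) (a : (X.chainComplex R).X p ⟶ R)
    (ha : (X.chainComplex R).d (p + 1) p ≫ a = 0) :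
    (X.chainComplex R).homologyπ n ≫ capHomology X h a ha =
      capCycles X h a ha ≫ (X.chainComplex R).homologyπ q :=
  ((X.chainComplex R).homologyIsCokernel (n + 1) n (by simp)).fac _ WalkingParallelPair.one

lemma capHomology_coboundary {p q n : ℕ} (h : p + q = n) (b : (X.chainComplex R).X (p - 1) ⟶ R)
    (ha : (X.chainComplex R).d (p + 1) p ≫ (X.chainComplex R).d p (p - 1) ≫ b = 0) :
    capHomology X h ((X.chainComplex R).d p (p - 1) ≫ b) ha = 0 := by
  rw [← cancel_epi ((X.chainComplex R).homologyπ n), π_capHomology, comp_zero]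
  rcases p with _ | p
  · have : capCycles X h ((X.chainComplex R).d 0 (0 - 1) ≫ b) ha = 0 := by
      rw [← cancel_mono ((X.chainComplex R).iCycles q), capCycles_i, zero_comp]
      have hz : cap X h ((X.chainComplex R).d 0 (0 - 1) ≫ b) = 0 := by
        apply SSet.chainComplex_hom_ext
        intro x
        rw [ι_cap, (X.chainComplex R).shape 0 (0 - 1) (by simp)]
        simp
      rw [hz, comp_zero]
    rw [this, zero_comp]
  · obtain rfl : n = p + q + 1 := by lia
    refine (X.chainComplex R).liftCycles_homologyπ_eq_zero_of_boundary _ _ _ (i' := q + 1)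
      ((X.chainComplex R).iCycles _ ≫ (-((-1 : ℤ) ^ p • cap X (by lia) b))) ?_
    have key := d_cap X (p := p) (q := q) rfl b
    have key2 := congrArg ((X.chainComplex R).iCycles _ ≫ ·) key
    simp only [HomologicalComplex.iCycles_d_assoc, zero_comp, Preadditive.comp_add] at key2
    change _ ≫ cap X _ ((X.chainComplex R).d (p + 1) p ≫ b) = _
    rw [eq_neg_of_add_eq_zero_left key2.symm]
    simp

lemma capHomology_add {p q n : ℕ} (h : p + q = n) (a b : (X.chainComplex R).X p ⟶ R)
    (ha : (X.chainComplex R).d (p + 1) p ≫ a = 0) (hb : (X.chainComplex R).d (p + 1) p ≫ b = 0)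
    (hab : (X.chainComplex R).d (p + 1) p ≫ (a + b) = 0) :
    capHomology X h (a + b) hab = capHomology X h a ha + capHomology X h b hb := by
  have e : capCycles X h (a + b) hab = capCycles X h a ha + capCycles X h b hb := by
    rw [← cancel_mono ((X.chainComplex R).iCycles q)]
    simp only [Preadditive.add_comp, capCycles_i, cap_add, Preadditive.comp_add]
  rw [← cancel_epi ((X.chainComplex R).homologyπ n)]
  simp only [Preadditive.comp_add, π_capHomology, e, Preadditive.add_comp]

lemma capHomology_smul {S : Type*} [Semiring S] [Linear S C] {p q n : ℕ} (h : p + q = n) (r : S)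
    (a : (X.chainComplex R).X p ⟶ R) (ha : (X.chainComplex R).d (p + 1) p ≫ a = 0)
    (hra : (X.chainComplex R).d (p + 1) p ≫ (r • a) = 0) :
    capHomology X h (r • a) hra = r • capHomology X h a ha := by
  have e : capCycles X h (r • a) hra = r • capCycles X h a ha := by
    rw [← cancel_mono ((X.chainComplex R).iCycles q)]
    simp only [Linear.smul_comp, capCycles_i, cap_smul, Linear.comp_smul]
  rw [← cancel_epi ((X.chainComplex R).homologyπ n)]
  simp only [Linear.comp_smul, π_capHomology, e, Linear.smul_comp]

/-- Evaluation `H_n(X; R) ⟶ R` of an `n`-cocycle. -/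
def evalHomology {n : ℕ} (a : (X.chainComplex R).X n ⟶ R)
    (ha : (X.chainComplex R).d (n + 1) n ≫ a = 0) : X.homology R n ⟶ R :=
  ((X.chainComplex R).homologyIsCokernel (n + 1) n (by simp)).desc
    (CokernelCofork.ofπ ((X.chainComplex R).iCycles n ≫ a) (by simp [ha]))

lemma π_evalHomology {n : ℕ} (a : (X.chainComplex R).X n ⟶ R)
    (ha : (X.chainComplex R).d (n + 1) n ≫ a = 0) :
    (X.chainComplex R).homologyπ n ≫ evalHomology X a ha = (X.chainComplex R).iCycles n ≫ a :=
  ((X.chainComplex R).homologyIsCokernel (n + 1) n (by simp)).fac _ WalkingParallelPair.one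

lemma evalHomology_add {n : ℕ} (a b : (X.chainComplex R).X n ⟶ R)
    (ha : (X.chainComplex R).d (n + 1) n ≫ a = 0) (hb : (X.chainComplex R).d (n + 1) n ≫ b = 0)
    (hab : (X.chainComplex R).d (n + 1) n ≫ (a + b) = 0) :
    evalHomology X (a + b) hab = evalHomology X a ha + evalHomology X b hb := by
  rw [← cancel_epi ((X.chainComplex R).homologyπ n)]
  simp only [Preadditive.comp_add, π_evalHomology]

lemma evalHomology_smul {S : Type*} [Semiring S] [Linear S C] {n : ℕ} (r : S)
    (a : (X.chainComplex R).X n ⟶ R) (ha : (X.chainComplex R).d (n + 1) n ≫ a = 0)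
    (hra : (X.chainComplex R).d (n + 1) n ≫ (r • a) = 0) :
    evalHomology X (r • a) hra = r • evalHomology X a ha := by
  rw [← cancel_epi ((X.chainComplex R).homologyπ n)]
  simp only [Linear.comp_smul, π_evalHomology]

lemma evalHomology_coboundary {n : ℕ} (b : (X.chainComplex R).X (n - 1) ⟶ R)
    (ha : (X.chainComplex R).d (n + 1) n ≫ (X.chainComplex R).d n (n - 1) ≫ b = 0) :
    evalHomology X ((X.chainComplex R).d n (n - 1) ≫ b) ha = 0 := by
  rw [← cancel_epi ((X.chainComplex R).homologyπ n), π_evalHomology]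
  simp

end Cap

section Singular

open CategoryTheory CategoryTheory.Limits

/- Singular homology and cohomology of a space, and the intersection form -/

variable (R : Type) [CommRing R] (M : Type) [TopologicalSpace M]

/-- The singular simplicial set of `M`. -/
abbrev singularSet : SSet.{0} := TopCat.toSSet.obj (TopCat.of M)

/-- The singular chain complex `C_*(M; R)`. -/
abbrev chains : ChainComplex (ModuleCat.{0} R) ℕ :=
  (singularSet M).chainComplex (ModuleCat.of R R)

/-- Singular homology `H_n(M; R)`. -/
abbrev Homology (n : ℕ) : ModuleCat.{0} R :=
  (singularSet M).homology (ModuleCat.of R R) n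

/-- `Homology` is Mathlib's singular homology functor. -/
lemma homology_eq_singularHomologyFunctor (n : ℕ) : Homology R M n =
    ((AlgebraicTopology.singularHomologyFunctor (ModuleCat.{0} R) n).obj
      (ModuleCat.of R R)).obj (TopCat.of M) := rfl

/-- Singular cochains `C^p(M; R) = Hom_R(C_p(M; R), R)`. -/
abbrev SingularCochains (p : ℕ) : Type := (chains R M).X p ⟶ ModuleCat.of R R

/-- Cocycles: the cochains `a` with `a ∘ ∂ = 0`. -/
def cocycles (p : ℕ) : Submodule R (SingularCochains R M p) :=
  LinearMap.ker (Linear.leftComp R (ModuleCat.of R R) ((chains R M).d (p + 1) p))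

/-- Coboundaries: the cochains `b ∘ ∂` (only `0` for `p = 0`, since `d 0 0 = 0`). -/
def coboundaries (p : ℕ) : Submodule R (SingularCochains R M p) :=
  LinearMap.range (Linear.leftComp R (ModuleCat.of R R) ((chains R M).d p (p - 1)))

/-- Singular cohomology `H^p(M; R)`. -/
abbrev Cohomology (p : ℕ) : Type :=
  cocycles R M p ⧸ (coboundaries R M p).submoduleOf (cocycles R M p)

/-- The Kronecker pairing `⟨[a], [z]⟩ = a(z)`. -/
def kronecker (n : ℕ) : Cohomology R M n →ₗ[R] (Homology R M n →ₗ[R] R) :=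
  Submodule.liftQ _
    { toFun := fun a => (evalHomology (singularSet M) a.1 a.2).hom
      map_add' := by
        intro a b
        rw [← ModuleCat.hom_add]
        exact congrArg ModuleCat.Hom.hom
          (evalHomology_add (singularSet M) a.1 b.1 a.2 b.2 (a + b).2)
      map_smul' := by
        intro r a
        rw [RingHom.id_apply, ← ModuleCat.hom_smul]
        exact congrArg ModuleCat.Hom.hom
          (evalHomology_smul (singularSet M) r a.1 a.2 (r • a).2) }
    (by
      rintro ⟨_, ha⟩ ⟨b, rfl⟩
      exact congrArg ModuleCat.Hom.hom (evalHomology_coboundary (singularSet M) b ha))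

/-- The cap product `[a] ⌢ [z] = [a ⌢ z]`, a bilinear map
`H^p(M; R) × H_n(M; R) → H_q(M; R)` for `p + q = n`. -/
def capProduct {p q n : ℕ} (h : p + q = n) :
    Cohomology R M p →ₗ[R] (Homology R M n →ₗ[R] Homology R M q) :=
  Submodule.liftQ _
    { toFun := fun a => (capHomology (singularSet M) h a.1 a.2).hom
      map_add' := by
        intro a b
        rw [← ModuleCat.hom_add]
        exact congrArg ModuleCat.Hom.hom
          (capHomology_add (singularSet M) h a.1 b.1 a.2 b.2 (a + b).2)
      map_smul' := by
        intro r a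
        rw [RingHom.id_apply, ← ModuleCat.hom_smul]
        exact congrArg ModuleCat.Hom.hom
          (capHomology_smul (singularSet M) h r a.1 a.2 (r • a).2) }
    (by
      rintro ⟨_, ha⟩ ⟨b, rfl⟩
      exact congrArg ModuleCat.Hom.hom (capHomology_coboundary (singularSet M) h b ha))

variable {M}

/-- The inclusion `M \ {x} → M`. -/
def puncturedInclusion (x : M) : TopCat.of {y : M // y ≠ x} ⟶ TopCat.of M :=
  TopCat.ofHom ⟨Subtype.val, continuous_subtype_val⟩

/-- The inclusion `C_*(M \ {x}; R) → C_*(M; R)`. -/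
def puncturedChainMap (x : M) : chains R {y : M // y ≠ x} ⟶ chains R M :=
  SSet.chainComplexMap (TopCat.toSSet.map (puncturedInclusion x)) (ModuleCat.of R R)

/-- The local homology `H_n(M, M \ {x}; R)`, the homology of `C_*(M; R) / C_*(M \ {x}; R)`. -/
abbrev LocalHomology (x : M) (n : ℕ) : ModuleCat.{0} R :=
  (cokernel (puncturedChainMap R x)).homology n

/-- The natural map `H_n(M; R) → H_n(M, M \ {x}; R)`. -/
def toLocalHomology (x : M) (n : ℕ) : Homology R M n ⟶ LocalHomology R x n :=
  HomologicalComplex.homologyMap (cokernel.π (puncturedChainMap R x)) n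

/-- `μ ∈ H_n(M; R)` is a fundamental class (an `R`-orientation of the closed `n`-manifold `M`):
it restricts to a generator of `H_n(M, M \ {x}; R)` for every point `x`. -/
def IsFundamentalClass {n : ℕ} (μ : Homology R M n) : Prop :=
  ∀ x : M, Submodule.span R {(toLocalHomology R x n).hom μ} = ⊤

variable (M) in
/-- A closed (compact, without boundary) topological `n`-manifold. -/
structure IsClosedManifold (n : ℕ) : Prop where
  t2 : T2Space M
  compact : CompactSpace M
  charts : Nonempty (ChartedSpace (EuclideanSpace ℝ (Fin n)) M)

/-- The map `H^k(M; R) → H_k(M; R)`, `α ↦ α ⌢ μ`, for `μ ∈ H_{2k}(M; R)`. -/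
def dualityMap {k : ℕ} (μ : Homology R M (2 * k)) : Cohomology R M k →ₗ[R] Homology R M k :=
  (capProduct R M (two_mul k).symm).flip μ

/-- The form `(α, β) ↦ ⟨α ⌣ β, μ⟩` on `H^k(M; R)`. The evaluation of the cup product is written
as `⟨β, α ⌢ μ⟩`: for cochains, `(a ⌣ b)(x) = a(x|[0, …, k]) b(x|[k, …, 2k]) = b(a ⌢ x)`. -/
def cupForm {k : ℕ} (μ : Homology R M (2 * k)) :
    Cohomology R M k →ₗ[R] Cohomology R M k →ₗ[R] R :=
  ((kronecker R M k).flip.comp (dualityMap R μ))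

open Classical in
/-- The intersection form on `H_k(M; R)`: the form `(α, β) ↦ ⟨α ⌣ β, μ⟩` on `H^k(M; R)`
transported to `H_k(M; R)` by the Poincaré duality isomorphism `α ↦ α ⌢ μ`. For a fundamental
class `μ` of a closed manifold, and for `M = ℝ^{2k}` with `k ≥ 1` (where all groups involved are
`0`, so that the form is `0`), the duality map is bijective; otherwise the value is set to `0`. -/
def intersectionForm {k : ℕ} (μ : Homology R M (2 * k)) :
    Homology R M k →ₗ[R] Homology R M k →ₗ[R] R :=
  if h : Function.Bijective (dualityMap R μ) then
    (cupForm R μ).compl₁₂ (LinearEquiv.ofBijective (dualityMap R μ) h).symm.toLinearMap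
      (LinearEquiv.ofBijective (dualityMap R μ) h).symm.toLinearMap
  else 0

/-- The matrix of a bilinear form on `H` with respect to an isomorphism of `H` with
`R^b ⊕ (torsion)`: its entries are the values on the basis vectors of `R^b`. -/
def formMatrix {R H : Type*} [CommRing R] [AddCommGroup H] [Module R H] {b : ℕ}
    (Ω : H →ₗ[R] H →ₗ[R] R) (e : H ≃ₗ[R] (Fin b → R) × Submodule.torsion R H) :
    Matrix (Fin b) (Fin b) R :=
  Matrix.of fun i j => Ω (e.symm (Pi.single i 1, 0)) (e.symm (Pi.single j 1, 0))

end Singular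

section Complex

/- Simplicial complexes, the deleted product, and the van Kampen obstruction -/

variable {E : Type*} [NormedAddCommGroup E] [NormedSpace ℝ E]
  (K : Geometry.SimplicialComplex ℝ E) (k : ℕ) (R : Type) [CommRing R]

/-- The simplices of `K` with `m` vertices, i.e. of dimension `m - 1`. -/
def Simplex (m : ℕ) : Type _ := {s : Finset E // s ∈ K.faces ∧ s.card = m}

/-- `K` is a (finite) `k`-complex. -/
structure IsComplexOfDim : Prop where
  finite : K.faces.Finite
  card_le : ∀ s ∈ K.faces, s.card ≤ k + 1

/-- An orientation of each simplex of `K`, given by an ordering `[v_0, …, v_d]` of its vertices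
(orderings that differ by an even permutation give the same orientation). -/
def Orientations : Type _ := ∀ (m : ℕ) (s : Simplex K m), Fin m ≃ s.1

variable {K}

/-- The `j`-th vertex of a simplex in the ordering that represents its orientation. -/
def Orientations.vertex (o : Orientations K) {m : ℕ} (s : Simplex K m) (j : Fin m) : E :=
  (o m s j : E)

open Classical in
/-- The incidence number `[η : σ]` of a `(k-1)`-simplex `η` and a `k`-simplex `σ = [v_0, …, v_k]`.
If `η ⊆ σ`, there are exactly one `i` and one permutation `π` such that removing `v_i` from
`[v_0, …, v_k]` gives the vertices of `η` in the order permuted by `π`, and then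
`[η : σ] = (-1)^i sgn π`. -/
def incidence (o : Orientations K) {k : ℕ} (η : Simplex K k) (σ : Simplex K (k + 1)) : ℤ :=
  ∑ i : Fin (k + 1), ∑ π : Equiv.Perm (Fin k),
    if ∀ j, o.vertex σ (i.succAbove j) = o.vertex η (π j)
    then (-1) ^ i.1 * (Equiv.Perm.sign π : ℤ) else 0

variable (K)

/-- The cells `σ × τ` of dimension `2k` of the deleted product of the `k`-complex `K`: ordered
pairs of disjoint `k`-simplices. -/
def DeletedCell : Type _ :=
  {c : Simplex K (k + 1) × Simplex K (k + 1) // Disjoint c.1.1 c.2.1}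

/-- Pairs of a `(k-1)`-simplex `η` and a `k`-simplex `μ` that are disjoint. -/
def FingerPair : Type _ :=
  {p : Simplex K k × Simplex K (k + 1) // Disjoint p.1.1 p.2.1}

/-- The cochains `C^{2k}(K̃; R)`, given by their values on the `2k`-cells of the deleted product. -/
abbrev Cochain : Type _ := DeletedCell K k → R

variable {K k}

open Classical in
/-- The finger move cochain `φ_{η,μ}`. -/
def fingerMove (o : Orientations K) (p : FingerPair K k) : Cochain K k R := fun c =>
  if p.1.1.1 ⊆ c.1.1.1 ∧ p.1.2 = c.1.2 then (incidence o p.1.1 c.1.1 : R)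
  else if p.1.1.1 ⊆ c.1.2.1 ∧ p.1.2 = c.1.1 then (-1) ^ k * (incidence o p.1.1 c.1.2 : R)
  else 0

/-- The span `F` of the finger move cochains. -/
def fingerSpan (o : Orientations K) : Submodule R (Cochain K k R) :=
  Submodule.span R (Set.range (fingerMove R o))

variable {R} in
/-- The class `[ξ]` of a cochain modulo `F`. All finger move cochains are skew-symmetric, so the
quotient `C_skew / F` of the skew-symmetric cochains is a submodule of this quotient. -/
def cochainClass (o : Orientations K) (ξ : Cochain K k R) : Cochain K k R ⧸ fingerSpan R o :=
  Submodule.Quotient.mk ξ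

variable {R} in
/-- The cochain `ω_ψ(σ × τ) = Ω(ψ(σ), ψ(τ))` of a homomorphism `ψ : C_k(K; R) → H`. -/
def omega {H : Type*} [AddCommGroup H] [Module R H] (Ω : H →ₗ[R] H →ₗ[R] R)
    (ψ : (Simplex K (k + 1) →₀ R) →ₗ[R] H) : Cochain K k R := fun c =>
  Ω (ψ (Finsupp.single c.1.1 1)) (ψ (Finsupp.single c.1.2 1))

variable (K k) in
/-- The underlying set `|L|` of the `(k-1)`-skeleton `L` of `K`. -/
def skeletonSpace : Set E := ⋃ s ∈ {s ∈ K.faces | s.card ≤ k}, convexHull ℝ (s : Set E)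

variable (K) in
/-- `f : |K| → ℝ^{2k}` is a general position map (the values of `f` outside `|K|` play no role):
there is a triangulation `T` of `|K|`, subdividing `K`, such that `f` is affine on each simplex of
`T` (so `f` is PL); `f` is injective on `|L|`; only finitely many points have more than one
preimage in `|K|`, and each of them has exactly two, both outside `|L|`; the crossings are
transversal: the two preimages are interior points of `k`-simplices of `T` whose images under `f`
have complementary directions. -/
def IsGeneralPosition {k : ℕ} (f : E → EuclideanSpace ℝ (Fin (2 * k))) : Prop :=
  ∃ T : Geometry.SimplicialComplex ℝ E, T.faces.Finite ∧ T.space = K.space ∧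
    (∀ s ∈ T.faces, ∃ t ∈ K.faces, convexHull ℝ (s : Set E) ⊆ convexHull ℝ (t : Set E)) ∧
    (∀ s ∈ T.faces, ∃ A : E →ᵃ[ℝ] EuclideanSpace ℝ (Fin (2 * k)),
      Set.EqOn f A (convexHull ℝ (s : Set E))) ∧
    Set.InjOn f (skeletonSpace K k) ∧
    {x | ∃ y ∈ K.space, ∃ y' ∈ K.space, y ≠ y' ∧ f y = x ∧ f y' = x}.Finite ∧
    (∀ y ∈ K.space, ∀ y' ∈ K.space, y ≠ y' → f y = f y' →
      (∀ z ∈ K.space, f z = f y → z = y ∨ z = y') ∧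
      y ∉ skeletonSpace K k ∧ y' ∉ skeletonSpace K k ∧
      ∃ s ∈ T.faces, ∃ t ∈ T.faces, s.card = k + 1 ∧ t.card = k + 1 ∧
        y ∈ intrinsicInterior ℝ (convexHull ℝ (s : Set E)) ∧
        y' ∈ intrinsicInterior ℝ (convexHull ℝ (t : Set E)) ∧
        IsCompl (vectorSpan ℝ (f '' (s : Set E))) (vectorSpan ℝ (f '' (t : Set E))))

/-- The images under (the differential at `y` of) `f` of the edge vectors
`v_1 - v_0, …, v_k - v_0` of `σ = [v_0, …, v_k]`. -/
def imageFrame (o : Orientations K) {k : ℕ} (f : E → EuclideanSpace ℝ (Fin (2 * k)))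
    (σ : Simplex K (k + 1)) (y : E) : Fin k → EuclideanSpace ℝ (Fin (2 * k)) := fun j =>
  lineDeriv ℝ f y (o.vertex σ j.succ - o.vertex σ 0)

/-- The sign of the crossing `f y = f y'`, with `y` in the interior of `σ` and `y'` in the interior
of `τ`: the sign of the product orientation of `f(σ) × f(τ)` in `ℝ^{2k}`. -/
def crossingSign (o : Orientations K) {k : ℕ} (f : E → EuclideanSpace ℝ (Fin (2 * k)))
    (σ τ : Simplex K (k + 1)) (y y' : E) : SignType :=
  SignType.sign (Matrix.det (Matrix.of fun i j : Fin (2 * k) =>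
    (Fin.append (imageFrame o f σ y) (imageFrame o f τ y') (Fin.cast (two_mul k) j)) i))

/-- The intersection number `f(σ) · f(τ)`: the sum of the signs of all crossings. -/
def intersectionNumber (o : Orientations K) {k : ℕ} (f : E → EuclideanSpace ℝ (Fin (2 * k)))
    (σ τ : Simplex K (k + 1)) : ℤ :=
  ∑ᶠ p ∈ {p : E × E | p.1 ∈ convexHull ℝ (σ.1 : Set E) ∧ p.2 ∈ convexHull ℝ (τ.1 : Set E) ∧
    f p.1 = f p.2}, (crossingSign o f σ τ p.1 p.2 : ℤ)

/-- The cochain `ϑ_f(σ × τ) = f(σ) · f(τ)`, with coefficients in `R`. -/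
def theta (o : Orientations K) {k : ℕ} (f : E → EuclideanSpace ℝ (Fin (2 * k))) :
    Cochain K k R := fun c => (intersectionNumber o f c.1.1 c.1.2 : R)

/-- The van Kampen obstruction `[ϑ_f]` of a general position map `f : |K| → ℝ^{2k}`. (It does not
depend on `f`; statements about it are made for every general position map.) -/
def vanKampenObstruction (o : Orientations K) {k : ℕ}
    (f : E → EuclideanSpace ℝ (Fin (2 * k))) : Cochain K k R ⧸ fingerSpan (k := k) R o :=
  cochainClass o (theta R o f)

end Complex

end VanKampen

end

/-!
The class `[ω_ψ] - õ(K)` vanishes if and only if `ϑ - ω_ψ` lies in the span `F` of the finger move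
cochains, since `[ϑ] = õ(K)`. As `K` is finite, there are finitely many finger moves, and
membership in `F` means that `ϑ - ω_ψ = ∑ x_{η,μ} φ_{η,μ}` for some coefficients `x_{η,μ}`
(`VanKampen.mem_fingerSpan_iff`).

It remains to parametrize the cochains `ω_ψ`. A bilinear form with values in the ring itself
vanishes on torsion, so `Ω` is determined by its matrix on the free part: `Ω(u, v) = yᵀ A_Ω z`, where
`y` and `z` are the components of `u` and `v` in `R^b` (`VanKampen.form_eq_formMatrix`). The group
`C_k(K; R)` is free on the `k`-simplices, so `ψ` is the choice of the values `ψ(σ)`, and their free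
components `y_σ` can be any vectors.
-/

namespace VanKampen

section Form

variable {R H : Type*} [CommRing R] [AddCommGroup H] [Module R H]

lemma form_torsion_left (Ω : H →ₗ[R] H →ₗ[R] R) {t : H} (ht : t ∈ Submodule.torsion R H) (v : H) :
    Ω t v = 0 := by
  obtain ⟨a, ha⟩ := (Submodule.mem_torsion_iff t).mp ht
  have h : (a : R) * Ω t v = 0 := by
    rw [← smul_eq_mul, ← LinearMap.smul_apply, ← map_smul]
    change Ω (a • t) v = 0
    rw [ha, map_zero, LinearMap.zero_apply]
  exact (mul_left_mem_nonZeroDivisors_eq_zero_iff a.2).mp h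

lemma form_torsion_right (Ω : H →ₗ[R] H →ₗ[R] R) (u : H) {t : H}
    (ht : t ∈ Submodule.torsion R H) : Ω u t = 0 :=
  form_torsion_left Ω.flip ht u

/-- A bilinear form is given by its matrix on the components in `R^b`, because it vanishes on
torsion. -/
lemma form_eq_formMatrix {b : ℕ} (Ω : H →ₗ[R] H →ₗ[R] R)
    (e : H ≃ₗ[R] (Fin b → R) × Submodule.torsion R H) (u v : H) :
    Ω u v = (e u).1 ⬝ᵥ (formMatrix Ω e).mulVec (e v).1 := by
  have htor (t : Submodule.torsion R H) : e.symm (0, t) ∈ Submodule.torsion R H := by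
    obtain ⟨a, ha⟩ := (Submodule.mem_torsion_iff (t : H)).mp t.2
    refine (Submodule.mem_torsion_iff _).mpr ⟨a, ?_⟩
    change (a : R) • e.symm (0, t) = 0
    have ht : (a : R) • t = 0 := Subtype.ext ha
    rw [← map_smul, Prod.smul_mk, smul_zero, ht]
    exact map_zero e.symm
  have hdecomp (w : H) :
      w = e.symm ((e w).1, 0) + e.symm (0, (e w).2) := by
    rw [← map_add]
    simp
  have hfree (y : Fin b → R) :
      e.symm (y, 0) = ∑ i, y i • e.symm (Pi.single i 1, 0) := by
    simp only [← map_smul, ← map_sum]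
    congr 1
    ext1
    · simp only [Prod.fst_sum, Prod.smul_fst]
      exact pi_eq_sum_univ' y
    · simp [Prod.snd_sum]
  have hΩ : Ω u v = Ω (e.symm ((e u).1, 0)) (e.symm ((e v).1, 0)) := by
    conv_lhs => rw [hdecomp u, hdecomp v]
    rw [map_add (Ω _), form_torsion_right Ω _ (htor _), add_zero, map_add Ω, LinearMap.add_apply,
      form_torsion_left Ω (htor _), add_zero]
  rw [hΩ, hfree (e u).1, hfree (e v).1]
  simp only [map_sum, map_smul, LinearMap.sum_apply, LinearMap.smul_apply, smul_eq_mul, dotProduct,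
    Matrix.mulVec, formMatrix, Matrix.of_apply, Finset.mul_sum]
  rw [Finset.sum_comm]
  exact Finset.sum_congr rfl fun i _ => Finset.sum_congr rfl fun j _ => by ring

end Form

section FingerMoves

variable {E : Type*} [NormedAddCommGroup E] [NormedSpace ℝ E]
  {K : Geometry.SimplicialComplex ℝ E} {k : ℕ}

lemma IsComplexOfDim.finite_simplex (hK : IsComplexOfDim K k) (m : ℕ) : Finite (Simplex K m) :=
  (hK.finite.subset fun _ hs => hs.1 : {s : Finset E | s ∈ K.faces ∧ s.card = m}.Finite).to_subtype

lemma IsComplexOfDim.finite_fingerPair (hK : IsComplexOfDim K k) : Finite (FingerPair K k) :=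
  have := hK.finite_simplex k
  have := hK.finite_simplex (k + 1)
  inferInstanceAs (Finite {p : Simplex K k × Simplex K (k + 1) // Disjoint p.1.1 p.2.1})

lemma mem_fingerSpan_iff (hK : IsComplexOfDim K k) (R : Type) [CommRing R] (o : Orientations K)
    (ξ : Cochain K k R) :
    ξ ∈ fingerSpan R o ↔ ∃ x : FingerPair K k → R,
      ∀ c, ∑ᶠ p : FingerPair K k, x p * fingerMove R o p c = ξ c := by
  have := hK.finite_fingerPair
  cases nonempty_fintype (FingerPair K k)
  rw [fingerSpan, Submodule.mem_span_range_iff_exists_fun]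
  simp only [funext_iff, Finset.sum_apply, Pi.smul_apply, smul_eq_mul, finsum_eq_sum_of_fintype]

end FingerMoves

end VanKampen

theorem theorem8 {k : ℕ} (hk : 1 ≤ k)
    (R : Type) [CommRing R] (hR : Nonempty (R ≃+* ℤ) ∨ Nonempty (R ≃+* ZMod 2))
    {E : Type*} [NormedAddCommGroup E] [NormedSpace ℝ E]
    (K : Geometry.SimplicialComplex ℝ E) (hK : VanKampen.IsComplexOfDim K k)
    (o : VanKampen.Orientations K)
    (M : Type) [TopologicalSpace M] (μ : VanKampen.Homology R M (2 * k))
    (hM : (VanKampen.IsClosedManifold M (2 * k) ∧ VanKampen.IsFundamentalClass R μ) ∨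
      Nonempty (M ≃ₜ EuclideanSpace ℝ (Fin (2 * k))))
    (b : ℕ) (e : VanKampen.Homology R M k ≃ₗ[R]
      (Fin b → R) × Submodule.torsion R (VanKampen.Homology R M k))
    (g : E → EuclideanSpace ℝ (Fin (2 * k))) (hg : VanKampen.IsGeneralPosition K g)
    (θ : VanKampen.Cochain K k R)
    (hθ : VanKampen.cochainClass o θ = VanKampen.vanKampenObstruction R o g) :
    (∃ ψ : (VanKampen.Simplex K (k + 1) →₀ R) →ₗ[R] VanKampen.Homology R M k,
      VanKampen.cochainClass o (VanKampen.omega (VanKampen.intersectionForm R μ) ψ) -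
        VanKampen.vanKampenObstruction R o g = 0) ↔
    (∃ (x : VanKampen.FingerPair K k → R) (y : VanKampen.Simplex K (k + 1) → Fin b → R),
      ∀ c : VanKampen.DeletedCell K k,
        (∑ᶠ p : VanKampen.FingerPair K k, x p * VanKampen.fingerMove R o p c) +
          y c.1.1 ⬝ᵥ ((VanKampen.formMatrix (VanKampen.intersectionForm R μ) e).mulVec (y c.1.2)) =
        θ c) := by
  have key (ψ : (VanKampen.Simplex K (k + 1) →₀ R) →ₗ[R] VanKampen.Homology R M k) :
      VanKampen.cochainClass o (VanKampen.omega (VanKampen.intersectionForm R μ) ψ) -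
        VanKampen.vanKampenObstruction R o g = 0 ↔ ∃ x : VanKampen.FingerPair K k → R,
          ∀ c, (∑ᶠ p : VanKampen.FingerPair K k, x p * VanKampen.fingerMove R o p c) +
            VanKampen.omega (VanKampen.intersectionForm R μ) ψ c = θ c := by
    rw [← hθ, sub_eq_zero, eq_comm, VanKampen.cochainClass, VanKampen.cochainClass,
      Submodule.Quotient.eq, VanKampen.mem_fingerSpan_iff hK]
    simp only [Pi.sub_apply, eq_sub_iff_add_eq]
  simp only [key, VanKampen.omega, VanKampen.form_eq_formMatrix _ e]
  constructor
  · rintro ⟨ψ, x, hx⟩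
    exact ⟨x, fun σ => (e (ψ (Finsupp.single σ 1))).1, hx⟩
  · rintro ⟨x, y, hxy⟩
    refine ⟨Finsupp.linearCombination R fun σ => e.symm (y σ, 0), x, fun c => ?_⟩
    simpa using hxy c
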